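/- Let $n\in\mathbb N$, $s\in\mathbb R$, $\mu_s(x)=(1+|x|^2)^{s/2}$, and $\widehat f(t)=\int_{\mathbb R^n} f(x)e^{-2\pi i\langle x,t\rangle}\,dx$, extended to tempered distributions. Let $H^s=H^s(\mathbb R^n)$ be the Hilbert space of all $f\in\mathcal S'(\mathbb R^n)$ with $\mu_s\widehat f\in L^2(\mathbb R^n)$, with inner product $\langle f,g\rangle_{H^s}=\int_{\mathbb R^n}\widehat f\,\overline{\widehat g}\,\mu_s^2$. Let $\ell^2_s$ be the Hilbert space of all sequences $c=(c_k)_{k\in\mathbb Z^n}$ with $(c_k\mu_s(k))_k\in\ell^2(\mathbb Z^n)$, with inner product $\sum_k c_k\overline{d_k}\mu_s(k)^2$. Put $\mathbb T^n=[-\tfrac12,\tfrac12)^n$ with Lebesgue measure. For $f\in H^s$ put $$\mathcal T_sf(t)=\Big(\frac{\mu_s(t+k)\widehat f(t+k)}{\mu_s(k)}\Big)_{k\in\mathbb Z^n}\in\ell^2_s\qquad\text{for a.e. }t\in\mathbb T^n .$$ A linear subspace $V\subset H^s$ is shift-invariant (SI) if $T_kf=f(\cdot-k)\in V$ for all $f\in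 V$, $k\in\mathbb Z^n$. A measurable range function is a map $J$ from $\mathbb T^n$ to the closed subspaces of $\ell^2_s$ such that $t\mapsto\langle P_{J(t)}b,a\rangle_{\ell^2_s}$ is Lebesgue measurable for all $a,b\in\ell^2_s$, where $P_{J(t)}$ is the orthogonal projection onto $J(t)$. It is a range function of the closed SI space $V$ if $V=\{f\in H^s:\mathcal T_sf(t)\in J(t)\text{ for a.e. }t\in\mathbb T^n\}$, and then the dimension function of $V$ is $\dim_V(t)=\dim J(t)\in\{0,1,2,\dots\}\cup\{+\infty\}$. Theorem. Let $V_s\subset H^s$ be a closed SI space and let $L:V_s\to V_s$ be a shift-preserving operator, that is, a bounded linear operator with $LT_k=T_kL$ for all $k\in\mathbb Z^n$. Then $\widetilde{V_s}=\overline{L(V_s)}$ (closure in $H^s$) is a closed SI space, both $V_s$ and $\widetilde{V_s}$ have a measurable range function, and, whichever measurable range functions of the two spaces are used to compute the dimension functions, $$\dim_{\widetilde{V_s}}(t)\le\dim_{V_s}(t)\qquad\text{for a.e. }t\in\mathbb T^n .$$ -/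

import Mathlib

open MeasureTheory TemperedDistribution FourierTransform
open scoped SchwartzMap ENNReal ContDiff

noncomputable section

namespace SobolevSI

/-! ### Sobolev spaces `H^s(ℝⁿ)` -/

/-- Euclidean space `ℝⁿ`. -/
abbrev E (n : ℕ) : Type := EuclideanSpace ℝ (Fin n)

/-- The weight `μ_s(x) = (1 + |x|²)^{s/2}`. -/
def weight (n : ℕ) (s : ℝ) (x : E n) : ℝ := (1 + ‖x‖ ^ 2) ^ (s / 2)

lemma weight_pos {n : ℕ} (s : ℝ) (x : E n) : 0 < weight n s x := by
  unfold weight; positivity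

/-- `H^s` as a linear subspace of the tempered distributions: those `f` for which
`(1 + |·|²)^{s/2} f̂` belongs to `L²`. -/
def sobolevSubmodule (n : ℕ) (s : ℝ) : Submodule ℂ 𝓢'(E n, ℂ) where
  carrier := {f | MemSobolev s 2 f}
  add_mem' hf hg := hf.add hg
  zero_mem' := memSobolev_fun_zero (E n) ℂ s 2
  smul_mem' c _ hf := hf.smul c

/-- The Sobolev space `H^s(ℝⁿ)`. It is a type of its own since it carries the Hilbert norm below
and not the topology of `𝓢'`. -/
def SobolevSpace (n : ℕ) (s : ℝ) : Type := sobolevSubmodule n s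

instance (n : ℕ) (s : ℝ) : AddCommGroup (SobolevSpace n s) :=
  inferInstanceAs (AddCommGroup (sobolevSubmodule n s))

instance (n : ℕ) (s : ℝ) : Module ℂ (SobolevSpace n s) :=
  inferInstanceAs (Module ℂ (sobolevSubmodule n s))

/-- The tempered distribution underlying an element of `H^s`. -/
def SobolevSpace.toDistribution {n : ℕ} {s : ℝ} : SobolevSpace n s →ₗ[ℂ] 𝓢'(E n, ℂ) :=
  (sobolevSubmodule n s).subtype

lemma SobolevSpace.memSobolev {n : ℕ} {s : ℝ} (f : SobolevSpace n s) :
    MemSobolev s 2 f.toDistribution :=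
  f.2

/-- A tempered distribution in `H^s` as an element of `SobolevSpace n s`. -/
def SobolevSpace.mk {n : ℕ} {s : ℝ} (f : 𝓢'(E n, ℂ)) (hf : MemSobolev s 2 f) : SobolevSpace n s :=
  ⟨f, hf⟩

lemma exists_weightedFourier {n : ℕ} {s : ℝ} (f : SobolevSpace n s) :
    ∃ u : Lp ℂ 2 (volume : Measure (E n)),
      smulLeftCLM ℂ (fun x : E n ↦ ((weight n s x : ℝ) : ℂ)) (𝓕 f.toDistribution)
        = (u : 𝓢'(E n, ℂ)) :=
  memSobolev_iff_exists_smulLeftCLM_fourier.1 f.memSobolev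

lemma toTemperedDistribution_injective {n : ℕ} {u v : Lp ℂ 2 (volume : Measure (E n))}
    (h : (u : 𝓢'(E n, ℂ)) = (v : 𝓢'(E n, ℂ))) : u = v :=
  LinearMap.ker_eq_bot.1
    (Lp.ker_toTemperedDistributionCLM_eq_bot (F := ℂ) (μ := (volume : Measure (E n))) (p := 2)) h

/-- The `L²` function `μ_s f̂`, for `f ∈ H^s`. -/
def weightedFourier (n : ℕ) (s : ℝ) :
    SobolevSpace n s →ₗ[ℂ] Lp ℂ 2 (volume : Measure (E n)) where
  toFun f := (exists_weightedFourier f).choose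
  map_add' f g := by
    apply toTemperedDistribution_injective
    have h := (Lp.toTemperedDistributionCLM ℂ (volume : Measure (E n)) 2).map_add
      (exists_weightedFourier f).choose (exists_weightedFourier g).choose
    simp only [Lp.toTemperedDistributionCLM_apply] at h
    rw [h, ← (exists_weightedFourier (f + g)).choose_spec,
      ← (exists_weightedFourier f).choose_spec, ← (exists_weightedFourier g).choose_spec,
      map_add, FourierTransform.fourier_add, map_add]
  map_smul' c f := by
    apply toTemperedDistribution_injective
    have h := (Lp.toTemperedDistributionCLM ℂ (volume : Measure (E n)) 2).map_smul
      c (exists_weightedFourier f).choose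
    simp only [Lp.toTemperedDistributionCLM_apply] at h
    rw [RingHom.id_apply, h, ← (exists_weightedFourier (c • f)).choose_spec,
      ← (exists_weightedFourier f).choose_spec, map_smul, FourierTransform.fourier_smul, map_smul]

lemma weightedFourier_spec {n : ℕ} {s : ℝ} (f : SobolevSpace n s) :
    smulLeftCLM ℂ (fun x : E n ↦ ((weight n s x : ℝ) : ℂ)) (𝓕 f.toDistribution)
      = (weightedFourier n s f : 𝓢'(E n, ℂ)) :=
  (exists_weightedFourier f).choose_spec

lemma weightedFourier_injective (n : ℕ) (s : ℝ) :
    Function.Injective (weightedFourier n s) := by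
  intro f g h
  have h1 : besselPotential (E n) ℂ s f.toDistribution
      = besselPotential (E n) ℂ s g.toDistribution := by
    have h2 : 𝓕 (besselPotential (E n) ℂ s f.toDistribution)
        = 𝓕 (besselPotential (E n) ℂ s g.toDistribution) := by
      rw [fourier_besselPotential_eq_smulLeftCLM_fourier_apply,
        fourier_besselPotential_eq_smulLeftCLM_fourier_apply]
      exact (weightedFourier_spec f).trans ((congrArg _ h).trans (weightedFourier_spec g).symm)
    have h3 := congrArg (fun u : 𝓢'(E n, ℂ) ↦ 𝓕⁻ u) h2
    simpa only [FourierTransform.fourierInv_fourier_eq] using h3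
  have h3 := (besselPotential_neg_apply_eq_iff s _ _).2 h1
  rw [(besselPotential_neg_apply_eq_iff s _ _).2 rfl] at h3
  exact Subtype.ext h3.symm

/-- The norm `‖f‖_{H^s} = ‖μ_s f̂‖_{L²}`. -/
instance (n : ℕ) (s : ℝ) : NormedAddCommGroup (SobolevSpace n s) :=
  NormedAddCommGroup.induced _ _ (weightedFourier n s) (weightedFourier_injective n s)

/-- The inner product of `H^s`, that is, the integral of `f̂` times the conjugate of `ĝ` times
`μ_s²` (in Mathlib's convention conjugate-linear in the first variable). -/
instance (n : ℕ) (s : ℝ) : InnerProductSpace ℂ (SobolevSpace n s) :=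
  InnerProductSpace.induced (weightedFourier n s)

/-! ### Integer translations -/

/-- `k ∈ ℤⁿ` as a point of `ℝⁿ`. -/
def latticePoint {n : ℕ} (k : Fin n → ℤ) : E n := WithLp.toLp 2 fun i ↦ (k i : ℝ)

/-- Translation `f ↦ f(· - a)` of tempered distributions: `⟨f(· - a), φ⟩ = ⟨f, φ(· + a)⟩`. -/
def translateDistribution {n : ℕ} (a : E n) : 𝓢'(E n, ℂ) →L[ℂ] 𝓢'(E n, ℂ) :=
  PointwiseConvergenceCLM.precomp _ (SchwartzMap.compSubConstCLM ℂ (-a))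

lemma hasTemperateGrowth_cexp_mul (c : ℝ) :
    (fun x : ℝ ↦ Complex.exp (c * Complex.I * x)).HasTemperateGrowth := by
  have hd : ∀ m : ℕ, iteratedDeriv m (fun x : ℝ ↦ Complex.exp (c * Complex.I * x))
      = fun x : ℝ ↦ (c * Complex.I) ^ m * Complex.exp (c * Complex.I * x) := by
    intro m
    induction m with
    | zero => ext; simp
    | succ m ih =>
      rw [iteratedDeriv_succ, ih]
      ext x
      have h1 : HasDerivAt (fun x : ℝ ↦ (c * Complex.I * x : ℂ)) (c * Complex.I) x := by
        simpa using (Complex.ofRealCLM.hasDerivAt (x := x)).const_mul (c * Complex.I : ℂ)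
      rw [(h1.cexp.const_mul _).deriv]
      ring
  have hc : ContDiff ℝ ∞ (fun x : ℝ ↦ Complex.exp (c * Complex.I * x)) :=
    (contDiff_const.mul Complex.ofRealCLM.contDiff).cexp
  refine ⟨hc, fun m ↦ ⟨0, |c| ^ m, fun x ↦ ?_⟩⟩
  rw [norm_iteratedFDeriv_eq_norm_iteratedDeriv, hd]
  have h2 : ‖Complex.exp (c * Complex.I * x)‖ = 1 := by
    rw [Complex.norm_exp]; simp
  simp [h2]

/-- The character `x ↦ e^{-2πi⟨x, a⟩}`. -/
def character {n : ℕ} (a : E n) (x : E n) : ℂ :=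
  Complex.exp (((-2 * Real.pi : ℝ) : ℂ) * Complex.I * (inner ℝ x a : ℝ))

lemma hasTemperateGrowth_character {n : ℕ} (a : E n) : (character a).HasTemperateGrowth :=
  (hasTemperateGrowth_cexp_mul (-2 * Real.pi)).comp (f := fun x : E n ↦ inner ℝ x a)
    (Function.hasTemperateGrowth_inner_left a)

lemma translateDistribution_eq {n : ℕ} (a : E n) (f : 𝓢'(E n, ℂ)) :
    translateDistribution a f = fourierMultiplierCLM ℂ (character a) f := by
  ext u
  rw [fourierMultiplierCLM_apply_apply]
  change f (SchwartzMap.compSubConstCLM ℂ (-a) u) = f _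
  refine congrArg f ?_
  rw [← FourierTransform.fourier_fourierInv_eq (E := 𝓢(E n, ℂ)) (F := 𝓢(E n, ℂ))
    (SchwartzMap.compSubConstCLM ℂ (-a) u)]
  refine congrArg (fun v : 𝓢(E n, ℂ) ↦ 𝓕 v) ?_
  ext x
  rw [SchwartzMap.smulLeftCLM_apply_apply (hasTemperateGrowth_character a)]
  rw [SchwartzMap.fourierInv_coe, SchwartzMap.fourierInv_coe, Real.fourierInv_eq',
    Real.fourierInv_eq', ← integral_add_right_eq_self
      (fun v ↦ Complex.exp (((2 * Real.pi * inner ℝ v x : ℝ) : ℂ) * Complex.I) • u v) a,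
    smul_eq_mul, ← integral_const_mul]
  refine integral_congr_ae (Filter.Eventually.of_forall fun v ↦ ?_)
  simp only [smul_eq_mul, SchwartzMap.compSubConstCLM_apply, sub_neg_eq_add]
  rw [← mul_assoc, character, ← Complex.exp_add]
  congr 2
  rw [inner_add_left, real_inner_comm a x]
  push_cast
  ring

lemma memSobolev_translateDistribution {n : ℕ} {s : ℝ} (a : E n) {f : 𝓢'(E n, ℂ)}
    (hf : MemSobolev s 2 f) : MemSobolev s 2 (translateDistribution a f) := by
  rw [translateDistribution_eq]
  refine hf.fourierMultiplierCLM_of_bounded (hasTemperateGrowth_character a) ⟨1, fun x ↦ ?_⟩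
  rw [character, Complex.norm_exp]
  simp

/-- The translation `T_k f = f(· - k)` on `H^s`, for `k ∈ ℤⁿ`. -/
def translate {n : ℕ} {s : ℝ} (k : Fin n → ℤ) (f : SobolevSpace n s) : SobolevSpace n s :=
  .mk (translateDistribution (latticePoint k) f.toDistribution)
    (memSobolev_translateDistribution _ f.memSobolev)

/-- A linear subspace of `H^s` is shift-invariant if it is mapped into itself by all `T_k`. -/
def IsShiftInvariant {n : ℕ} {s : ℝ} (V : Submodule ℂ (SobolevSpace n s)) : Prop :=
  ∀ f ∈ V, ∀ k : Fin n → ℤ, translate k f ∈ V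

/-- A bounded operator `L : V → V` on a shift-invariant space is shift-preserving if
`L T_k = T_k L` for all `k ∈ ℤⁿ`. -/
def IsShiftPreserving {n : ℕ} {s : ℝ} {V : Submodule ℂ (SobolevSpace n s)}
    (hV : IsShiftInvariant V) (L : V →L[ℂ] V) : Prop :=
  ∀ (k : Fin n → ℤ) (f : V),
    (L ⟨translate k f, hV f f.2 k⟩ : SobolevSpace n s) = translate k (L f : SobolevSpace n s)

/-- The closure in `H^s` of the image `L(V)`. -/
def closureImage {n : ℕ} {s : ℝ} {V : Submodule ℂ (SobolevSpace n s)} (L : V →L[ℂ] V) :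
    Submodule ℂ (SobolevSpace n s) :=
  ((LinearMap.range (L : V →ₗ[ℂ] V)).map V.subtype).topologicalClosure

/-! ### The weighted sequence space `ℓ²_s(ℤⁿ)` -/

/-- The sequences `c` on `ℤⁿ` with `c μ_s ∈ ℓ²`. -/
def weightedSeqSubmodule (n : ℕ) (s : ℝ) : Submodule ℂ ((Fin n → ℤ) → ℂ) where
  carrier := {c | Memℓp (fun k ↦ (weight n s (latticePoint k) : ℂ) * c k) 2}
  add_mem' hf hg := by simpa [mul_add] using! hf.add hg
  zero_mem' := by simpa using! (zero_memℓp : Memℓp (0 : (Fin n → ℤ) → ℂ) 2)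
  smul_mem' c _ hf := by simpa [mul_left_comm] using! hf.const_smul c

/-- The weighted sequence space `ℓ²_s(ℤⁿ)`. -/
def WeightedSeq (n : ℕ) (s : ℝ) : Type := weightedSeqSubmodule n s

instance (n : ℕ) (s : ℝ) : AddCommGroup (WeightedSeq n s) :=
  inferInstanceAs (AddCommGroup (weightedSeqSubmodule n s))

instance (n : ℕ) (s : ℝ) : Module ℂ (WeightedSeq n s) :=
  inferInstanceAs (Module ℂ (weightedSeqSubmodule n s))

/-- The isomorphism `c ↦ c μ_s` of `ℓ²_s` onto `ℓ²`. -/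
def weightedSeqEquiv (n : ℕ) (s : ℝ) :
    WeightedSeq n s ≃ₗ[ℂ] lp (fun _ : Fin n → ℤ ↦ ℂ) 2 where
  toFun c := ⟨fun k ↦ (weight n s (latticePoint k) : ℂ) * c.1 k, c.2⟩
  map_add' c d := by
    apply lp.ext; funext k; exact mul_add _ _ _
  map_smul' a c := by
    apply lp.ext; funext k; exact mul_left_comm _ _ _
  invFun d := ⟨fun k ↦ (weight n s (latticePoint k) : ℂ)⁻¹ * d k, by
    have h : (fun k ↦ (weight n s (latticePoint k) : ℂ) *
        ((weight n s (latticePoint k) : ℂ)⁻¹ * d k)) = d := by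
      funext k
      exact mul_inv_cancel_left₀ (Complex.ofReal_ne_zero.2 (weight_pos s _).ne') _
    change Memℓp _ 2
    rw [h]
    exact lp.memℓp d⟩
  left_inv c := by
    apply Subtype.ext; funext k
    exact inv_mul_cancel_left₀ (Complex.ofReal_ne_zero.2 (weight_pos s _).ne') _
  right_inv d := by
    apply lp.ext; funext k
    exact mul_inv_cancel_left₀ (Complex.ofReal_ne_zero.2 (weight_pos s _).ne') _

/-- The norm `‖c‖_{ℓ²_s} = ‖c μ_s‖_{ℓ²}`. -/
instance (n : ℕ) (s : ℝ) : NormedAddCommGroup (WeightedSeq n s) :=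
  NormedAddCommGroup.induced _ _ (weightedSeqEquiv n s) (weightedSeqEquiv n s).injective

/-- The inner product of `ℓ²_s`: the sum of `c_k` times the conjugate of `d_k` times `μ_s(k)²`
(in Mathlib's convention conjugate-linear in the first variable). -/
instance (n : ℕ) (s : ℝ) : InnerProductSpace ℂ (WeightedSeq n s) :=
  InnerProductSpace.induced (weightedSeqEquiv n s)

instance (n : ℕ) (s : ℝ) : CompleteSpace (WeightedSeq n s) := by
  let e : WeightedSeq n s ≃ₗᵢ[ℂ] lp (fun _ : Fin n → ℤ ↦ ℂ) 2 :=
    ⟨weightedSeqEquiv n s, fun _ ↦ rfl⟩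
  exact (completeSpace_congr (e := e.toEquiv) e.isometry.isUniformEmbedding).2 inferInstance

/-! ### Fibers, range functions and dimension functions -/

/-- The set `𝕋ⁿ = [-1/2, 1/2)ⁿ`. -/
def torus (n : ℕ) : Set (E n) := {t | ∀ i, t i ∈ Set.Ico (-(1 / 2) : ℝ) (1 / 2)}

/-- `𝕋ⁿ` carries Lebesgue measure. -/
instance (n : ℕ) : MeasureSpace (torus n) := Measure.Subtype.measureSpace

open Classical in
/-- The mapping `𝒯_s`: with `g = (1 - Δ/4π²)^{s/2} f`, so that `ĝ = μ_s f̂ ∈ L²`, the fiber of `f`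
at `t` is the sequence `(ĝ(t + k) / μ_s(k))_k`. It lies in `ℓ²_s` for almost every `t`; on the
remaining null set the value is set to `0`. -/
def fiber {n : ℕ} {s : ℝ} (f : SobolevSpace n s) (t : torus n) : WeightedSeq n s :=
  if h : (fun k : Fin n → ℤ ↦ weightedFourier n s f (t + latticePoint k) /
      (weight n s (latticePoint k) : ℂ)) ∈ weightedSeqSubmodule n s
  then ⟨_, h⟩ else 0

/-- A range function: a mapping from `𝕋ⁿ` to the closed subspaces of `ℓ²_s`. -/
abbrev RangeFunction (n : ℕ) (s : ℝ) : Type := torus n → ClosedSubmodule ℂ (WeightedSeq n s)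

/-- A range function is measurable if the orthogonal projections onto its values are (weakly)
measurable. For a scalar function, `AEMeasurable` is measurability with respect to the
σ-algebra of Lebesgue measurable sets. -/
def RangeFunction.IsMeasurable {n : ℕ} {s : ℝ} (J : RangeFunction n s) : Prop :=
  ∀ a b : WeightedSeq n s,
    AEMeasurable (fun t : torus n ↦ inner ℂ a ((J t).toSubmodule.starProjection b)) volume

/-- `J` is the range function of `V`: it is measurable, and `V = 𝒯_s⁻¹ M_J`, that is, `V` consists
of the `f ∈ H^s` with `𝒯_s f(t) ∈ J(t)` for almost every `t ∈ 𝕋ⁿ`. -/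
def IsRangeFunctionOf {n : ℕ} {s : ℝ} (J : RangeFunction n s)
    (V : Submodule ℂ (SobolevSpace n s)) : Prop :=
  J.IsMeasurable ∧ ∀ f : SobolevSpace n s, f ∈ V ↔ ∀ᵐ t : torus n, fiber f t ∈ J t

/-- The dimension function `t ↦ dim J(t)`, with values in `ℕ ∪ {∞}`. -/
def RangeFunction.dim {n : ℕ} {s : ℝ} (J : RangeFunction n s) (t : torus n) : ℕ∞ :=
  Cardinal.toENat (Module.rank ℂ (J t).toSubmodule)

end SobolevSI

end

/-! The map `𝒯_s` is an isometric isomorphism of `H^s` onto `L²(𝕋ⁿ; ℓ²_s)` that turns `T_k` into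
multiplication by a character (`fiberEquiv`, `fiberEquiv_translate`). An integrable function on `𝕋ⁿ`
is determined by its Fourier coefficients (`isDetermining_character`), so equality of inner products
against all translates becomes a.e. equality of inner products of fibers (`ae_inner_eq`). For a
dense sequence `u i` in a closed SI space, the closed spans of the fibers of the `u i` form a
measurable range function, and any other one agrees with it a.e. (`isRangeFunctionOf_fiberSpan`,
`ae_eq_fiberSpan`). The sequence `L (u i)` plays this role for the closure of `L(V)`. No fiberwise
operator is constructed. From `⟪T_k L u_i, u_j⟫ = ⟪T_k u_i, L* u_j⟫` one gets, for a.e. `t`, the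
adjoint relation between the fibers of `L u_i`, `u_j` and those of `u_i`, `L* u_j`. Hence every
linear relation among the fibers of the `u_i` also holds among those of the `L u_i`, and the
dimension cannot grow (`toENat_rank_closure_span_le`). -/

noncomputable section

namespace SobolevSI

/-! ### Rank comparison and weak measurability in a Hilbert space. -/

section LinearAlgebra

variable {H : Type*} [NormedAddCommGroup H] [InnerProductSpace ℂ H]

/-- The adjoint relation `h` makes `a i ↦ b i` a well-defined linear surjection between the spans.
Closures cost nothing: only a finite-dimensional right-hand side matters, and there the span of the
`b i` is already closed. -/
lemma toENat_rank_closure_span_le {a b d : ℕ → H}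
    (hb : ∀ i, b i ∈ (Submodule.span ℂ (Set.range a)).closure)
    (h : ∀ i j, inner ℂ (a j) (b i) = inner ℂ (d j) (a i)) :
    Cardinal.toENat (Module.rank ℂ (Submodule.span ℂ (Set.range b)).closure.toSubmodule)
      ≤ Cardinal.toENat (Module.rank ℂ (Submodule.span ℂ (Set.range a)).closure.toSubmodule) := by
  rcases le_or_gt Cardinal.aleph0
    (Module.rank ℂ (Submodule.span ℂ (Set.range a)).closure.toSubmodule) with hinf | hfin
  · rw [Cardinal.toENat_eq_top.2 hinf]; exact le_top
  -- If `∑ c i • a i = 0`, then `x = ∑ c i • b i` is orthogonal to every `a j` by `h`, yet lies in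
  -- their closed span by `hb`; so `x = 0`.
  have hker : LinearMap.ker (Finsupp.linearCombination ℂ a)
      ≤ LinearMap.ker (Finsupp.linearCombination ℂ b) := by
    intro c hc
    rw [LinearMap.mem_ker] at hc ⊢
    set x := Finsupp.linearCombination ℂ b c with hx
    have hxK : x ∈ (Submodule.span ℂ (Set.range a)).closure := by
      rw [hx, Finsupp.linearCombination_apply]
      exact Submodule.sum_mem _ fun i _ ↦ Submodule.smul_mem _ _ (hb i)
    have hxa : ∀ j, inner ℂ (a j) x = 0 := by
      intro j
      have h0 : inner ℂ (d j) (Finsupp.linearCombination ℂ a c) = 0 := by rw [hc, inner_zero_right]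
      rw [← h0, hx, Finsupp.linearCombination_apply, Finsupp.linearCombination_apply,
        Finsupp.sum, Finsupp.sum, inner_sum, inner_sum]
      simp only [inner_smul_right, h]
    have hxo : x ∈ (Submodule.span ℂ (Set.range a)).topologicalClosureᗮ := by
      rw [Submodule.orthogonal_closure, Submodule.mem_orthogonal]
      intro v hv
      induction hv using Submodule.span_induction with
      | mem v hv => obtain ⟨j, rfl⟩ := hv; exact hxa j
      | zero => exact inner_zero_left _
      | add v w _ _ hv hw => rw [inner_add_left, hv, hw, add_zero]
      | smul r v _ hv => rw [inner_smul_left, hv, mul_zero]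
    exact inner_self_eq_zero.1 ((Submodule.mem_orthogonal _ _).1 hxo x hxK)
  have hle : Module.rank ℂ (Submodule.span ℂ (Set.range b))
      ≤ Module.rank ℂ (Submodule.span ℂ (Set.range a)) := by
    rw [← Finsupp.range_linearCombination, ← Finsupp.range_linearCombination]
    exact LinearMap.rank_le_of_surjective
      ((Finsupp.linearCombination ℂ b).quotKerEquivRange.toLinearMap ∘ₗ Submodule.factor hker ∘ₗ
        (Finsupp.linearCombination ℂ a).quotKerEquivRange.symm.toLinearMap)
      ((Finsupp.linearCombination ℂ b).quotKerEquivRange.surjective.comp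
        ((Submodule.factor_surjective hker).comp
          (Finsupp.linearCombination ℂ a).quotKerEquivRange.symm.surjective))
  have hale : Submodule.span ℂ (Set.range a)
      ≤ (Submodule.span ℂ (Set.range a)).closure.toSubmodule :=
    Submodule.le_topologicalClosure _
  have hfin' : Module.rank ℂ (Submodule.span ℂ (Set.range b)) < Cardinal.aleph0 :=
    (hle.trans (Submodule.rank_mono hale)).trans_lt hfin
  have : FiniteDimensional ℂ (Submodule.span ℂ (Set.range b)) := Module.rank_lt_aleph0_iff.1 hfin'
  have hbc : (Submodule.span ℂ (Set.range b)).closure.toSubmodule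
      = Submodule.span ℂ (Set.range b) :=
    (Submodule.closed_of_finiteDimensional _).submodule_topologicalClosure_eq
  rw [hbc]
  exact Cardinal.toENat.monotone' (hle.trans (Submodule.rank_mono hale))

/-- The partial sums of the basis expansion are measurable and converge pointwise; countability of
`ι` makes the finite subsets a countably generated net. -/
lemma aestronglyMeasurable_of_forall_inner {T ι : Type*} [MeasurableSpace T] {μ : Measure T}
    [Countable ι] [CompleteSpace H] (e : HilbertBasis ι ℂ H) {h : T → H}
    (hh : ∀ i, AEMeasurable (fun t ↦ inner ℂ (e i) (h t)) μ) : AEStronglyMeasurable h μ := by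
  refine aestronglyMeasurable_of_tendsto_ae (u := Filter.atTop)
    (f := fun (S : Finset ι) t ↦ ∑ i ∈ S, inner ℂ (e i) (h t) • e i) (fun S ↦ ?_)
    (Filter.Eventually.of_forall fun t ↦ ?_)
  · refine Finset.aestronglyMeasurable_fun_sum _ fun i _ ↦ ?_
    exact (hh i).aestronglyMeasurable.smul_const _
  · have := e.hasSum_repr (h t)
    simp only [HilbertBasis.repr_apply_apply] at this
    exact this

end LinearAlgebra

/-! ### Shift-invariant subspaces of an abstract space isometric to `L²(T; H)`. -/

section FiberSpaces

variable {X H T κ ι : Type*} [NormedAddCommGroup X] [InnerProductSpace ℂ X]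
  [NormedAddCommGroup H] [InnerProductSpace ℂ H] [MeasurableSpace T] {μ : Measure T}

/-- The closed span of the values at `t` of a sequence in `L²(T; H)`. -/
def fiberSpan (Z : X ≃ₗᵢ[ℂ] Lp H 2 μ) (u : ℕ → X) (t : T) : ClosedSubmodule ℂ H :=
  (Submodule.span ℂ (Set.range fun i ↦ Z (u i) t)).closure

/-- The functions `χ k` determine integrable functions on `T` through their integrals. -/
def IsDetermining (μ : Measure T) (χ : κ → T → ℂ) : Prop :=
  ∀ φ : T → ℂ, Integrable φ μ → (∀ k, ∫ t, starRingEnd ℂ (χ k t) * φ t ∂μ = 0) → φ =ᵐ[μ] 0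

variable (Z : X ≃ₗᵢ[ℂ] Lp H 2 μ)

lemma coeFn_sub_ae (f g : X) : ∀ᵐ t ∂μ, Z (f - g) t = Z f t - Z g t := by
  rw [map_sub]; exact Lp.coeFn_sub _ _

lemma exists_toFun_ae_eq {h : T → H} (hh : MemLp h 2 μ) : ∃ f : X, ∀ᵐ t ∂μ, Z f t = h t :=
  ⟨Z.symm (hh.toLp h), by rw [Z.apply_symm_apply]; exact hh.coeFn_toLp⟩

/-- An `L²`-convergent sequence has a subsequence converging a.e., and the values of `fiberSpan` are
closed. -/
lemma ae_mem_fiberSpan_of_mem_closure {u : ℕ → X} {f : X} (hf : f ∈ closure (Set.range u)) :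
    ∀ᵐ t ∂μ, Z f t ∈ fiberSpan Z u t := by
  obtain ⟨v, hv, hlim⟩ := mem_closure_iff_seq_limit.1 hf
  have h1 : Filter.Tendsto (fun i ↦ Z (v i)) Filter.atTop (nhds (Z f)) :=
    (Z.continuous.tendsto f).comp hlim
  obtain ⟨ns, -, hns⟩ := (tendstoInMeasure_of_tendsto_Lp h1).exists_seq_tendsto_ae
  filter_upwards [hns] with t ht
  refine (fiberSpan Z u t).isClosed.mem_of_tendsto ht (Filter.Eventually.of_forall fun i ↦ ?_)
  obtain ⟨j, hj⟩ := hv (ns i)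
  rw [← hj]
  exact Submodule.le_topologicalClosure _ (Submodule.subset_span ⟨j, rfl⟩)

variable {χ : κ → T → ℂ} {τ : κ → X → X}

lemma inner_eq_integral (f g : X) : inner ℂ f g = ∫ t, inner ℂ (Z f t) (Z g t) ∂μ := by
  rw [← Z.inner_map_map, L2.inner_def]

variable {Z} in
lemma inner_shift (hτ : ∀ k f, ∀ᵐ t ∂μ, Z (τ k f) t = χ k t • Z f t) (k : κ) (f g : X) :
    inner ℂ (τ k f) g = ∫ t, starRingEnd ℂ (χ k t) * inner ℂ (Z f t) (Z g t) ∂μ := by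
  rw [inner_eq_integral Z]
  refine integral_congr_ae ?_
  filter_upwards [hτ k f] with t ht
  rw [ht, inner_smul_left]

variable {Z} in
-- Each hypothesis `h k` equates two generalized Fourier coefficients of the integrable functions `t
-- ↦ ⟪Z f t, Z g t⟫` and `t ↦ ⟪Z f' t, Z g' t⟫`.
lemma ae_inner_eq (hχ : IsDetermining μ χ)
    (hτ : ∀ k f, ∀ᵐ t ∂μ, Z (τ k f) t = χ k t • Z f t) {f g f' g' : X}
    (h : ∀ k, inner ℂ (τ k f) g = inner ℂ (τ k f') g') :
    ∀ᵐ t ∂μ, inner ℂ (Z f t) (Z g t) = inner ℂ (Z f' t) (Z g' t) := by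
  have hint : ∀ k, ∀ f g : X, Integrable (fun t ↦ starRingEnd ℂ (χ k t) *
      inner ℂ (Z f t) (Z g t)) μ := by
    intro k f g
    refine (L2.integrable_inner (𝕜 := ℂ) (Z (τ k f)) (Z g)).congr ?_
    filter_upwards [hτ k f] with t ht
    rw [ht, inner_smul_left]
  have h0 := hχ (fun t ↦ inner ℂ (Z f t) (Z g t) - inner ℂ (Z f' t) (Z g' t))
    ((L2.integrable_inner _ _).sub (L2.integrable_inner _ _)) fun k ↦ by
      simp only [mul_sub]
      rw [integral_sub (hint k f g) (hint k f' g'), ← inner_shift hτ, ← inner_shift hτ, h k,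
        sub_self]
  filter_upwards [h0] with t ht
  exact sub_eq_zero.1 ht

variable {Z} in
lemma ae_mem_orthogonal_fiberSpan (hχ : IsDetermining μ χ)
    (hτ : ∀ k f, ∀ᵐ t ∂μ, Z (τ k f) t = χ k t • Z f t) {u : ℕ → X} {q : X}
    (hq : ∀ k i, inner ℂ (τ k (u i)) q = 0) :
    ∀ᵐ t ∂μ, Z q t ∈ (fiberSpan Z u t).toSubmoduleᗮ := by
  have h1 : ∀ i, ∀ᵐ t ∂μ, inner ℂ (Z (u i) t) (Z q t) = 0 := by
    intro i
    filter_upwards [ae_inner_eq hχ hτ (f := u i) (g := q) (f' := u i) (g' := 0)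
      (fun k ↦ by rw [hq, inner_zero_right]),
      (by rw [map_zero]; exact Lp.coeFn_zero _ _ _ : ∀ᵐ t ∂μ, Z 0 t = 0)] with t ht h0
    rw [ht, h0, inner_zero_right]
  filter_upwards [ae_all_iff.2 h1] with t ht
  change Z q t ∈ (Submodule.span ℂ (Set.range fun i ↦ Z (u i) t)).topologicalClosureᗮ
  rw [Submodule.orthogonal_closure, Submodule.mem_orthogonal]
  intro v hv
  induction hv using Submodule.span_induction with
  | mem v hv => obtain ⟨j, rfl⟩ := hv; exact ht j
  | zero => exact inner_zero_left _
  | add v w _ _ hv hw => rw [inner_add_left, hv, hw, add_zero]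
  | smul r v _ hv => rw [inner_smul_left, hv, mul_zero]

variable {V : Submodule ℂ X}

variable {Z} in
-- Split `f` into its projection and the remainder. Fibers of the former lie in the fiber span; the
-- remainder is orthogonal to all translates of the `u i`, so its fibers lie in the orthogonal
-- complement.
lemma ae_starProjection_eq [V.HasOrthogonalProjection] [CompleteSpace H] (hχ : IsDetermining μ χ)
    (hτ : ∀ k f, ∀ᵐ t ∂μ, Z (τ k f) t = χ k t • Z f t) (hV : ∀ k, ∀ f ∈ V, τ k f ∈ V)
    {u : ℕ → X} (hu : ∀ i, u i ∈ V) (huV : (V : Set X) ⊆ closure (Set.range u)) (f : X) :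
    ∀ᵐ t ∂μ, Z (V.starProjection f) t = (fiberSpan Z u t).toSubmodule.starProjection (Z f t) := by
  filter_upwards [ae_mem_fiberSpan_of_mem_closure Z (huV (V.starProjection_apply_mem f)),
    ae_mem_orthogonal_fiberSpan (q := f - V.starProjection f) hχ hτ (u := u) fun k i ↦
      (V.mem_orthogonal _).1 (V.sub_starProjection_mem_orthogonal f) _ (hV k _ (hu i)),
    coeFn_sub_ae Z f (V.starProjection f)] with t h1 h2 h3
  rw [h3] at h2
  exact (Submodule.eq_starProjection_of_mem_orthogonal h1 h2).symm

variable {Z} in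
lemma mem_iff_ae_mem_fiberSpan [V.HasOrthogonalProjection] [CompleteSpace H]
    (hχ : IsDetermining μ χ)
    (hτ : ∀ k f, ∀ᵐ t ∂μ, Z (τ k f) t = χ k t • Z f t) (hV : ∀ k, ∀ f ∈ V, τ k f ∈ V)
    {u : ℕ → X} (hu : ∀ i, u i ∈ V) (huV : (V : Set X) ⊆ closure (Set.range u)) (f : X) :
    f ∈ V ↔ ∀ᵐ t ∂μ, Z f t ∈ fiberSpan Z u t := by
  refine ⟨fun hf ↦ ae_mem_fiberSpan_of_mem_closure Z (huV hf), fun hf ↦ ?_⟩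
  have h : Z (V.starProjection f) = Z f := by
    refine Lp.ext ?_
    filter_upwards [hf, ae_starProjection_eq hχ hτ hV hu huV f] with t h1 h2
    rw [h2]
    exact Submodule.starProjection_eq_self_iff.2 h1
  rw [← Z.injective h]
  exact V.starProjection_apply_mem f

variable {Z} in
-- As the measure is finite, the constant `b` is in `L²`; projecting it to `V` realizes the
-- pointwise projections of `b` by a measurable function.
lemma aemeasurable_inner_starProjection_fiberSpan [IsFiniteMeasure μ]
    [V.HasOrthogonalProjection] [CompleteSpace H] (hχ : IsDetermining μ χ)
    (hτ : ∀ k f, ∀ᵐ t ∂μ, Z (τ k f) t = χ k t • Z f t) (hV : ∀ k, ∀ f ∈ V, τ k f ∈ V)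
    {u : ℕ → X} (hu : ∀ i, u i ∈ V) (huV : (V : Set X) ⊆ closure (Set.range u)) (a b : H) :
    AEMeasurable (fun t ↦ inner ℂ a ((fiberSpan Z u t).toSubmodule.starProjection b)) μ := by
  obtain ⟨f, hf⟩ := exists_toFun_ae_eq Z (memLp_const (μ := μ) (p := 2) b)
  have h : AEMeasurable (fun t ↦ inner ℂ a (Z (V.starProjection f) t)) μ :=
    (aestronglyMeasurable_const.inner (Lp.aestronglyMeasurable _)).aemeasurable
  refine h.congr ?_
  filter_upwards [hf, ae_starProjection_eq hχ hτ hV hu huV f] with t h1 h2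
  rw [h2, h1]

variable {Z} in
-- Uniqueness of the range function. The fibers of the `u i` lie in `J t`; conversely, the
-- projections of the basis vectors to `J t` are fibers of elements of `V`, hence lie in the fiber
-- span, and they span a dense part of `J t`.
lemma ae_eq_fiberSpan [IsFiniteMeasure μ] [CompleteSpace H] [Countable ι]
    (e : HilbertBasis ι ℂ H) {u : ℕ → X} (hu : ∀ i, u i ∈ V)
    (huV : (V : Set X) ⊆ closure (Set.range u)) {J : T → ClosedSubmodule ℂ H}
    (hJ : ∀ a b, AEMeasurable (fun t ↦ inner ℂ a ((J t).toSubmodule.starProjection b)) μ)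
    (hJV : ∀ f, f ∈ V ↔ ∀ᵐ t ∂μ, Z f t ∈ J t) :
    ∀ᵐ t ∂μ, J t = fiberSpan Z u t := by
  have h1 : ∀ᵐ t ∂μ, ∀ i, Z (u i) t ∈ J t := ae_all_iff.2 fun i ↦ (hJV _).1 (hu i)
  have h2 : ∀ᵐ t ∂μ, ∀ i, (J t).toSubmodule.starProjection (e i) ∈ fiberSpan Z u t := by
    refine ae_all_iff.2 fun i ↦ ?_
    -- Weak measurability of `J`, together with the bound `‖P e_i‖ ≤ 1` on a finite measure space,
    -- gives an `L²` function.
    have hmem : MemLp (fun t ↦ (J t).toSubmodule.starProjection (e i)) 2 μ := by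
      refine MemLp.of_bound (aestronglyMeasurable_of_forall_inner e fun j ↦ hJ _ _) 1
        (Filter.Eventually.of_forall fun t ↦ ?_)
      exact ((J t).toSubmodule.norm_starProjection_apply_le (e i)).trans
        (e.orthonormal.norm_eq_one i).le
    obtain ⟨f, hf⟩ := exists_toFun_ae_eq Z hmem
    have hfV : f ∈ V := by
      rw [hJV]
      filter_upwards [hf] with t ht
      rw [ht]
      exact Submodule.starProjection_apply_mem _ _
    filter_upwards [hf, ae_mem_fiberSpan_of_mem_closure Z (huV hfV)] with t ht h
    rwa [← ht]
  filter_upwards [h1, h2] with t h1 h2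
  refine le_antisymm (fun x hx ↦ ?_) ?_
  · have hle : (Submodule.span ℂ (Set.range e)).topologicalClosure
        ≤ (fiberSpan Z u t).toSubmodule.comap
          ((J t).toSubmodule.starProjection : H →ₗ[ℂ] H) := by
      refine Submodule.topologicalClosure_minimal _ (Submodule.span_le.2 ?_)
        ((fiberSpan Z u t).isClosed.preimage (J t).toSubmodule.starProjection.continuous)
      rintro _ ⟨i, rfl⟩
      exact h2 i
    rw [e.dense_span] at hle
    have h3 : (J t).toSubmodule.starProjection x ∈ fiberSpan Z u t := hle Submodule.mem_top
    rwa [Submodule.starProjection_eq_self_iff.2 hx] at h3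
  · refine Submodule.topologicalClosure_minimal _ (Submodule.span_le.2 ?_) (J t).isClosed
    rintro _ ⟨i, rfl⟩
    exact h1 i

variable {Z} in
-- In the application `v = L u` and `w = L* u`. Since the sequences are countable, all the pairwise
-- relations hold off a single null set.
lemma ae_toENat_rank_fiberSpan_le (hχ : IsDetermining μ χ)
    (hτ : ∀ k f, ∀ᵐ t ∂μ, Z (τ k f) t = χ k t • Z f t) {u v w : ℕ → X}
    (hv : ∀ i, v i ∈ closure (Set.range u))
    (h : ∀ k i j, inner ℂ (τ k (v i)) (u j) = inner ℂ (τ k (u i)) (w j)) :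
    ∀ᵐ t ∂μ, Cardinal.toENat (Module.rank ℂ (fiberSpan Z v t).toSubmodule)
      ≤ Cardinal.toENat (Module.rank ℂ (fiberSpan Z u t).toSubmodule) := by
  have h1 : ∀ᵐ t ∂μ, ∀ i, Z (v i) t ∈ fiberSpan Z u t :=
    ae_all_iff.2 fun i ↦ ae_mem_fiberSpan_of_mem_closure Z (hv i)
  have h2 : ∀ᵐ t ∂μ, ∀ i j, inner ℂ (Z (v i) t) (Z (u j) t) = inner ℂ (Z (u i) t) (Z (w j) t) :=
    ae_all_iff.2 fun i ↦ ae_all_iff.2 fun j ↦ ae_inner_eq hχ hτ fun k ↦ h k i j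
  filter_upwards [h1, h2] with t h1 h2
  refine toENat_rank_closure_span_le (d := fun j ↦ Z (w j) t) h1 fun i j ↦ ?_
  rw [← inner_conj_symm, h2, inner_conj_symm]

end FiberSpaces

/-! ### Uniqueness of Fourier coefficients on `𝕋ⁿ`. -/

section FourierUniqueness

/-- Indicators of closed sets are bounded pointwise limits of continuous functions, and integrals
over closed sets determine an integrable function. -/
lemma ae_eq_zero_of_forall_integral_continuousMap_mul {Y : Type*} [MeasurableSpace Y]
    [PseudoMetricSpace Y] [BorelSpace Y] {ν : Measure Y} {φ : Y → ℂ} (hφ : Integrable φ ν)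
    (h : ∀ g : C(Y, ℂ), ∫ y, g y * φ y ∂ν = 0) : φ =ᵐ[ν] 0 := by
  refine ae_eq_zero_of_forall_setIntegral_isClosed_eq_zero hφ fun C hC ↦ ?_
  have hδ : ∀ n : ℕ, (0 : ℝ) < 1 / (n + 1) := fun n ↦ Nat.one_div_pos_of_nat
  let g : ℕ → C(Y, ℂ) := fun n ↦ ⟨fun y ↦ ((thickenedIndicator (hδ n) C y : ℝ) : ℂ),
    Complex.continuous_ofReal.comp (NNReal.continuous_coe.comp (map_continuous _))⟩
  have hlim : Filter.Tendsto (fun n ↦ ∫ y, g n y * φ y ∂ν) Filter.atTop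
      (nhds (∫ y, C.indicator φ y ∂ν)) := by
    refine tendsto_integral_of_dominated_convergence (fun y ↦ ‖φ y‖)
      (fun n ↦ (map_continuous (g n)).aestronglyMeasurable.mul hφ.1) hφ.norm
      (fun n ↦ Filter.Eventually.of_forall fun y ↦ ?_) (Filter.Eventually.of_forall fun y ↦ ?_)
    · rw [norm_mul]
      refine mul_le_of_le_one_left (norm_nonneg _) ?_
      have := thickenedIndicator_le_one (hδ n) C y
      simpa [g] using! this
    · have h1 := tendsto_pi_nhds.1 (thickenedIndicator_tendsto_indicator_closure hδ
        tendsto_one_div_add_atTop_nhds_zero_nat C) y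
      rw [hC.closure_eq] at h1
      have h2 := ((Complex.continuous_ofReal.comp NNReal.continuous_coe).tendsto _).comp h1
      have h3 := h2.mul_const (φ y)
      have h4 : C.indicator φ y = (Complex.ofReal ∘ NNReal.toReal)
          (C.indicator (fun _ ↦ 1) y) * φ y := by
        by_cases hy : y ∈ C <;> simp [hy]
      rw [h4]
      exact h3
  rw [← integral_indicator hC.measurableSet]
  exact tendsto_nhds_unique hlim (by simp only [h]; exact tendsto_const_nhds)

/-- Integration against `φ` is a continuous functional in the sup norm, and trigonometric
polynomials are dense. -/
lemma integral_continuousMap_mul_eq_zero_of_mFourier {d T : Type*} [Fintype d] [MeasurableSpace T]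
    {μ : Measure T} {π : T → UnitAddTorus d} (hπ : Measurable π) {φ : T → ℂ} (hφ : Integrable φ μ)
    (h : ∀ k : d → ℤ, ∫ t, UnitAddTorus.mFourier k (π t) * φ t ∂μ = 0)
    (g : C(UnitAddTorus d, ℂ)) : ∫ t, g (π t) * φ t ∂μ = 0 := by
  have hint : ∀ g : C(UnitAddTorus d, ℂ), Integrable (fun t ↦ g (π t) * φ t) μ := fun g ↦
    hφ.bdd_mul ((map_continuous g).measurable.comp hπ).aestronglyMeasurable
      (Filter.Eventually.of_forall fun t ↦ g.norm_coe_le_norm _)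
  let Λ : C(UnitAddTorus d, ℂ) →L[ℂ] ℂ := LinearMap.mkContinuous
    { toFun := fun g ↦ ∫ t, g (π t) * φ t ∂μ
      map_add' := fun g g' ↦ by
        rw [← integral_add (hint g) (hint g')]
        simp only [ContinuousMap.add_apply, add_mul]
      map_smul' := fun c g ↦ by
        rw [RingHom.id_apply, smul_eq_mul, ← integral_const_mul]
        simp only [ContinuousMap.smul_apply, smul_eq_mul, mul_assoc] }
    (∫ t, ‖φ t‖ ∂μ) fun g ↦ by
      rw [mul_comm, ← integral_const_mul]
      refine norm_integral_le_of_norm_le (hφ.norm.const_mul _)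
        (Filter.Eventually.of_forall fun t ↦ ?_)
      rw [norm_mul]
      exact mul_le_mul_of_nonneg_right (g.norm_coe_le_norm _) (norm_nonneg _)
  have hle : (Submodule.span ℂ (Set.range <| UnitAddTorus.mFourier (d := d))).topologicalClosure
      ≤ LinearMap.ker (Λ : C(UnitAddTorus d, ℂ) →ₗ[ℂ] ℂ) := by
    refine Submodule.topologicalClosure_minimal _ (Submodule.span_le.2 ?_) Λ.isClosed_ker
    rintro _ ⟨k, rfl⟩
    exact h k
  rw [UnitAddTorus.span_mFourier_closure_eq_top] at hle
  exact hle (Submodule.mem_top (x := g))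

lemma measurableSet_torus (n : ℕ) : MeasurableSet (torus n) := by
  have : torus n = ⋂ i, (fun t : E n ↦ t i) ⁻¹' Set.Ico (-(1 / 2) : ℝ) (1 / 2) := by
    ext; simp [torus]
  rw [this]
  exact MeasurableSet.iInter fun i ↦ measurableSet_Ico.preimage (by fun_prop)

/-- The projection of `𝕋ⁿ` to the quotient `ℝⁿ / ℤⁿ`. -/
def torusProj (n : ℕ) (t : torus n) : UnitAddTorus (Fin n) := fun i ↦ ((t : E n) i : UnitAddCircle)

lemma measurable_torusProj (n : ℕ) : Measurable (torusProj n) := by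
  refine measurable_pi_lambda _ fun i ↦ ?_
  refine (AddCircle.continuous_mk' (1 : ℝ)).measurable.comp ?_
  exact (by fun_prop : Measurable fun t : E n ↦ t i).comp measurable_subtype_coe

lemma torusProj_injective (n : ℕ) : Function.Injective (torusProj n) := by
  intro t t' h
  apply Subtype.ext
  ext i
  have hi : (((t : E n) i : ℝ) : UnitAddCircle) = ((t' : E n) i : ℝ) := congrFun h i
  have h1 := t.2 i
  have h2 := t'.2 i
  refine (AddCircle.coe_eq_coe_iff_of_mem_Ico (p := (1 : ℝ)) (a := -(1 / 2)) ⟨h1.1, ?_⟩ ⟨h2.1, ?_⟩).1 hi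
  · exact h1.2.trans_eq (by norm_num)
  · exact h2.2.trans_eq (by norm_num)

lemma mFourier_torusProj {n : ℕ} (k : Fin n → ℤ) (t : torus n) :
    UnitAddTorus.mFourier k (torusProj n t)
      = starRingEnd ℂ (character (latticePoint k) (t : E n)) := by
  simp only [UnitAddTorus.mFourier, ContinuousMap.coe_mk, torusProj, fourier_coe_apply]
  rw [character, ← Complex.exp_sum, ← Complex.exp_conj]
  congr 1
  simp only [map_mul, Complex.conj_ofReal, Complex.conj_I, PiLp.inner_apply, latticePoint]
  push_cast
  rw [Finset.mul_sum]
  refine Finset.sum_congr rfl fun i _ ↦ ?_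
  simp
  ring

lemma isDetermining_character (n : ℕ) :
    IsDetermining (volume : Measure (torus n))
      fun (k : Fin n → ℤ) (t : torus n) ↦ character (latticePoint k) (t : E n) := by
  intro φ hφ h
  -- An injective measurable map from a standard Borel space is a measurable embedding
  -- (Lusin–Souslin). So `φ` can be pushed to the compact torus although the half-open cube is not
  -- homeomorphic to it.
  have : StandardBorelSpace (torus n) := (measurableSet_torus n).standardBorel
  have he : MeasurableEmbedding (torusProj n) :=
    (measurable_torusProj n).measurableEmbedding (torusProj_injective n)
  have hext : ∀ t, Function.extend (torusProj n) φ 0 (torusProj n t) = φ t := fun t ↦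
    (torusProj_injective n).extend_apply _ _ _
  have h0 : Function.extend (torusProj n) φ 0 =ᵐ[volume.map (torusProj n)] 0 := by
    refine ae_eq_zero_of_forall_integral_continuousMap_mul ?_ fun g ↦ ?_
    · rw [he.integrable_map_iff]
      exact hφ.congr (Filter.Eventually.of_forall fun t ↦ (hext t).symm)
    · rw [he.integral_map]
      simp only [hext]
      exact integral_continuousMap_mul_eq_zero_of_mFourier (measurable_torusProj n) hφ
        (fun k ↦ by simpa only [mFourier_torusProj] using h k) g
  have h1 := he.ae_map_iff.1 h0
  filter_upwards [h1] with t ht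
  rw [← hext t, ht]
  rfl

end FourierUniqueness

/-! ### The tiling of `ℝⁿ` by integer translates of `𝕋ⁿ`. -/

section Tiling

variable {n : ℕ}

/-- The integer vector `k` with `x ∈ k + 𝕋ⁿ`. -/
def floorVec (x : E n) : Fin n → ℤ := fun i ↦ ⌊x i + 1 / 2⌋

/-- The point of `𝕋ⁿ` congruent to `x` modulo `ℤⁿ`. -/
def torusPart (x : E n) : torus n :=
  ⟨x - latticePoint (floorVec x), fun i ↦ by
    have h1 := Int.floor_le (x i + 1 / 2)
    have h2 := Int.lt_floor_add_one (x i + 1 / 2)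
    simp only [PiLp.sub_apply, latticePoint, floorVec, Set.mem_Ico]
    constructor <;> linarith⟩

lemma coe_torusPart (x : E n) : (torusPart x : E n) = x - latticePoint (floorVec x) := rfl

lemma measurable_floorVec : Measurable (floorVec (n := n)) :=
  measurable_pi_lambda _ fun i ↦
    Int.measurable_floor.comp (by fun_prop : Measurable fun x : E n ↦ x i + 1 / 2)

lemma measurable_torusPart : Measurable (torusPart (n := n)) := by
  refine Measurable.subtype_mk (measurable_id.sub ?_)
  exact (measurable_of_countable latticePoint).comp measurable_floorVec

lemma floorVec_add_latticePoint (t : torus n) (k : Fin n → ℤ) :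
    floorVec ((t : E n) + latticePoint k) = k := by
  funext i
  have h := t.2 i
  rw [Set.mem_Ico] at h
  simp only [floorVec, PiLp.add_apply, latticePoint]
  rw [Int.floor_eq_iff]
  constructor <;> linarith

lemma torusPart_add_latticePoint (t : torus n) (k : Fin n → ℤ) :
    torusPart ((t : E n) + latticePoint k) = t := by
  apply Subtype.ext
  rw [coe_torusPart, floorVec_add_latticePoint, add_sub_cancel_right]

lemma add_latticePoint_mem_floorVec_fiber_iff (x : E n) (k : Fin n → ℤ) :
    x + latticePoint k ∈ floorVec ⁻¹' {k} ↔ x ∈ torus n := by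
  constructor
  · intro h
    have h1 := (torusPart (x + latticePoint k)).2
    rwa [coe_torusPart, Set.mem_singleton_iff.1 h, add_sub_cancel_right] at h1
  · intro h
    exact floorVec_add_latticePoint ⟨x, h⟩ k

lemma lintegral_eq_tsum_torus (F : E n → ℝ≥0∞) :
    ∫⁻ x, F x = ∑' k : Fin n → ℤ, ∫⁻ t : torus n, F ((t : E n) + latticePoint k) := by
  have hS : ∀ k : Fin n → ℤ, MeasurableSet (floorVec (n := n) ⁻¹' {k}) := fun k ↦
    measurable_floorVec (measurableSet_singleton k)
  have hU : (⋃ k : Fin n → ℤ, floorVec (n := n) ⁻¹' {k}) = Set.univ := by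
    ext x; simp
  rw [← setLIntegral_univ, ← hU, lintegral_iUnion hS (fun k l hkl ↦
    Disjoint.preimage _ (Set.disjoint_singleton.2 hkl))]
  refine tsum_congr fun k ↦ ?_
  rw [← lintegral_indicator (hS k), ← lintegral_add_right_eq_self _ (latticePoint k)]
  refine Eq.trans ?_ (lintegral_subtype_comap (μ := volume) (measurableSet_torus n)
    fun x : E n ↦ F (x + latticePoint k)).symm
  rw [← lintegral_indicator (measurableSet_torus n)]
  refine lintegral_congr fun x ↦ ?_
  by_cases hx : x ∈ torus n
  · rw [Set.indicator_of_mem hx,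
      Set.indicator_of_mem ((add_latticePoint_mem_floorVec_fiber_iff x k).2 hx)]
  · rw [Set.indicator_of_notMem hx,
      Set.indicator_of_notMem (mt (add_latticePoint_mem_floorVec_fiber_iff x k).1 hx)]

lemma ae_torus_of_ae {p : E n → Prop} (h : ∀ᵐ x, p x) :
    ∀ᵐ t : torus n, ∀ k, p ((t : E n) + latticePoint k) := by
  refine ae_all_iff.2 fun k ↦ ?_
  have h1 : ∀ᵐ x : E n, p (x + latticePoint k) :=
    (measurePreserving_add_right volume (latticePoint k)).quasiMeasurePreserving.ae h
  exact (ae_restrict_iff_subtype (measurableSet_torus n)).1 (ae_restrict_of_ae h1)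

instance (n : ℕ) : IsFiniteMeasure (volume : Measure (torus n)) := by
  refine ⟨?_⟩
  have hb : Bornology.IsBounded (torus n) := by
    refine (Metric.isBounded_iff_subset_closedBall 0).2 ⟨√(∑ _ : Fin n, 1), fun t ht ↦ ?_⟩
    rw [mem_closedBall_zero_iff, EuclideanSpace.norm_eq]
    refine Real.sqrt_le_sqrt (Finset.sum_le_sum fun i _ ↦ ?_)
    have h := ht i
    rw [Set.mem_Ico] at h
    rw [Real.norm_eq_abs, sq_abs]
    nlinarith
  change Measure.comap Subtype.val (volume : Measure (E n)) Set.univ < ⊤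
  rw [comap_subtype_coe_apply (measurableSet_torus n), Set.image_univ, Subtype.range_coe]
  exact hb.measure_lt_top

end Tiling

/-! ### The fiber map as an isometric isomorphism. -/

section FiberMap

variable {n : ℕ} {s : ℝ}

/-- The standard Hilbert basis of `ℓ²_s`. -/
def weightedSeqBasis (n : ℕ) (s : ℝ) : HilbertBasis (Fin n → ℤ) ℂ (WeightedSeq n s) :=
  .ofRepr ⟨weightedSeqEquiv n s, fun _ ↦ rfl⟩

lemma inner_weightedSeqBasis (k : Fin n → ℤ) (c : WeightedSeq n s) :
    inner ℂ (weightedSeqBasis n s k) c = weightedSeqEquiv n s c k :=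
  ((weightedSeqBasis n s).repr_apply_apply c k).symm

lemma enorm_rpow_two_eq_tsum (d : lp (fun _ : Fin n → ℤ ↦ ℂ) 2) :
    ‖d‖ₑ ^ (2 : ℝ) = ∑' k, ‖d k‖ₑ ^ (2 : ℝ) := by
  have h := lp.hasSum_norm (p := 2) (by norm_num) d
  simp only [ENNReal.toReal_ofNat] at h
  have hof : ∀ {F : Type} [NormedAddCommGroup F] (x : F),
      ‖x‖ₑ ^ (2 : ℝ) = ENNReal.ofReal (‖x‖ ^ (2 : ℝ)) := fun x ↦ by
    rw [← ofReal_norm, ENNReal.ofReal_rpow_of_nonneg (norm_nonneg _) (by norm_num)]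
  rw [hof, ← h.tsum_eq, ENNReal.ofReal_tsum_of_nonneg (fun k ↦ by positivity) h.summable]
  exact tsum_congr fun k ↦ (hof _).symm

/-- Tiling and Tonelli: the integral of `|G|²` over `ℝⁿ` is the integral over `𝕋ⁿ` of the sum of
`|G|²` along `t + ℤⁿ`. -/
lemma eLpNorm_eq_of_ae_fiber {G : E n → ℂ} (hG : Measurable G) {h : torus n → WeightedSeq n s}
    (hh : ∀ᵐ t : torus n, ∀ k, weightedSeqEquiv n s (h t) k = G ((t : E n) + latticePoint k)) :
    eLpNorm h 2 volume = eLpNorm G 2 volume := by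
  rw [eLpNorm_eq_lintegral_rpow_enorm_toReal (by norm_num) (by norm_num),
    eLpNorm_eq_lintegral_rpow_enorm_toReal (by norm_num) (by norm_num), ENNReal.toReal_ofNat,
    lintegral_eq_tsum_torus, ← lintegral_tsum fun k ↦ by
      have : Measurable fun t : torus n ↦ (t : E n) + latticePoint k :=
        measurable_subtype_coe.add_const _
      exact ((hG.comp this).enorm.pow_const _).aemeasurable]
  congr 1
  refine lintegral_congr_ae ?_
  filter_upwards [hh] with t ht
  simp only [← ht]
  exact enorm_rpow_two_eq_tsum (weightedSeqEquiv n s (h t))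

/-- By tiling, the sum of `|μ_s f̂|²` along `t + ℤⁿ` has finite integral over `𝕋ⁿ`, so it is finite
a.e.; the division by `μ_s(k)` cancels the weight of `ℓ²_s`. -/
lemma ae_mem_weightedSeqSubmodule (f : SobolevSpace n s) :
    ∀ᵐ t : torus n, (fun k : Fin n → ℤ ↦ weightedFourier n s f (t + latticePoint k) /
      (weight n s (latticePoint k) : ℂ)) ∈ weightedSeqSubmodule n s := by
  have hm : Measurable (weightedFourier n s f) := (Lp.stronglyMeasurable _).measurable
  have hfin : ∫⁻ x, ‖weightedFourier n s f x‖ₑ ^ (2 : ℝ) < ⊤ := by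
    simpa using lintegral_rpow_enorm_lt_top_of_eLpNorm_lt_top (by norm_num) (by norm_num)
      (Lp.eLpNorm_lt_top (weightedFourier n s f))
  have hmk : ∀ k : Fin n → ℤ, Measurable fun t : torus n ↦
      ‖weightedFourier n s f ((t : E n) + latticePoint k)‖ₑ ^ (2 : ℝ) := fun k ↦
    (hm.comp (measurable_subtype_coe.add_const _)).enorm.pow_const _
  rw [lintegral_eq_tsum_torus, ← lintegral_tsum fun k ↦ (hmk k).aemeasurable] at hfin
  filter_upwards [ae_lt_top (Measurable.tsum hmk) hfin.ne] with t ht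
  change Memℓp (fun k ↦ (weight n s (latticePoint k) : ℂ) * _) 2
  simp only [mul_div_cancel₀ _ (Complex.ofReal_ne_zero.2 (weight_pos s _).ne')]
  refine memℓp_gen ?_
  have h := ENNReal.summable_toReal ht.ne
  simpa [← ENNReal.toReal_rpow] using h

lemma weightedSeqEquiv_fiber (f : SobolevSpace n s) :
    ∀ᵐ t : torus n, ∀ k, weightedSeqEquiv n s (fiber f t) k
      = weightedFourier n s f ((t : E n) + latticePoint k) := by
  filter_upwards [ae_mem_weightedSeqSubmodule f] with t ht k
  have h : fiber f t = ⟨_, ht⟩ := dif_pos ht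
  rw [h]
  exact mul_div_cancel₀ _ (Complex.ofReal_ne_zero.2 (weight_pos s _).ne')

lemma eLpNorm_fiber (f : SobolevSpace n s) :
    eLpNorm (fiber f) 2 volume = eLpNorm (weightedFourier n s f) 2 volume :=
  eLpNorm_eq_of_ae_fiber (Lp.stronglyMeasurable _).measurable (weightedSeqEquiv_fiber f)

lemma memLp_fiber (f : SobolevSpace n s) : MemLp (fiber f) 2 volume := by
  refine ⟨aestronglyMeasurable_of_forall_inner (weightedSeqBasis n s) fun k ↦ ?_, ?_⟩
  · have hm : Measurable fun t : torus n ↦ weightedFourier n s f ((t : E n) + latticePoint k) :=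
      (Lp.stronglyMeasurable _).measurable.comp (measurable_subtype_coe.add_const _)
    refine hm.aemeasurable.congr ?_
    filter_upwards [weightedSeqEquiv_fiber f] with t ht
    rw [inner_weightedSeqBasis, ht]
  · rw [eLpNorm_fiber]
    exact Lp.eLpNorm_lt_top _

lemma weightedSeq_ext {c d : WeightedSeq n s}
    (h : ∀ k, weightedSeqEquiv n s c k = weightedSeqEquiv n s d k) : c = d :=
  (weightedSeqEquiv n s).injective (lp.ext (funext h))

lemma fiber_add (f g : SobolevSpace n s) :
    ∀ᵐ t : torus n, fiber (f + g) t = fiber f t + fiber g t := by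
  filter_upwards [weightedSeqEquiv_fiber f, weightedSeqEquiv_fiber g,
    weightedSeqEquiv_fiber (f + g),
    ae_torus_of_ae (Lp.coeFn_add (weightedFourier n s f) (weightedFourier n s g))] with t h1 h2 h3 h4
  refine weightedSeq_ext fun k ↦ ?_
  rw [h3, map_add, h4, Pi.add_apply, map_add, lp.coeFn_add, Pi.add_apply, h1, h2]

lemma fiber_smul (c : ℂ) (f : SobolevSpace n s) :
    ∀ᵐ t : torus n, fiber (c • f) t = c • fiber f t := by
  filter_upwards [weightedSeqEquiv_fiber f, weightedSeqEquiv_fiber (c • f),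
    ae_torus_of_ae (Lp.coeFn_smul c (weightedFourier n s f))] with t h1 h2 h3
  refine weightedSeq_ext fun k ↦ ?_
  rw [h2, map_smul, h3, Pi.smul_apply, map_smul, lp.coeFn_smul, Pi.smul_apply, h1]

/-- The mapping `𝒯_s` as an isometry of `H^s` into `L²(𝕋ⁿ; ℓ²_s)`. -/
def fiberIsometry (n : ℕ) (s : ℝ) :
    SobolevSpace n s →ₗᵢ[ℂ] Lp (WeightedSeq n s) 2 (volume : Measure (torus n)) where
  toFun f := (memLp_fiber f).toLp _
  map_add' f g := by
    rw [← MemLp.toLp_add]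
    exact MemLp.toLp_congr _ _ (fiber_add f g)
  map_smul' c f := by
    rw [RingHom.id_apply, ← MemLp.toLp_const_smul]
    exact MemLp.toLp_congr _ _ (fiber_smul c f)
  norm_map' f := by
    change ‖(memLp_fiber f).toLp _‖ = ‖weightedFourier n s f‖
    rw [Lp.norm_toLp, eLpNorm_fiber, Lp.norm_def]

/-- The preimage of `u` is the Bessel potential of order `-s` of the inverse Fourier transform of
`u`. -/
lemma weightedFourier_surjective (n : ℕ) (s : ℝ) : Function.Surjective (weightedFourier n s) := by
  intro u
  have hb : besselPotential (E n) ℂ s (besselPotential (E n) ℂ (-s) (𝓕⁻ (u : 𝓢'(E n, ℂ))))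
      = 𝓕⁻ (u : 𝓢'(E n, ℂ)) := (besselPotential_neg_apply_eq_iff s _ _).1 rfl
  have hf : MemSobolev s 2 (besselPotential (E n) ℂ (-s) (𝓕⁻ (u : 𝓢'(E n, ℂ)))) :=
    ⟨𝓕⁻ u, by rw [hb]; exact Lp.fourierInv_toTemperedDistribution_eq u⟩
  refine ⟨SobolevSpace.mk _ hf, toTemperedDistribution_injective ?_⟩
  rw [← weightedFourier_spec]
  have h := fourier_besselPotential_eq_smulLeftCLM_fourier_apply s
    (besselPotential (E n) ℂ (-s) (𝓕⁻ (u : 𝓢'(E n, ℂ))))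
  rw [hb, FourierTransform.fourier_fourierInv_eq] at h
  exact h.symm

lemma measurable_inner_torusPart {H : Type*} [NormedAddCommGroup H] [InnerProductSpace ℂ H]
    (e : (Fin n → ℤ) → H) {h : torus n → H} (hh : StronglyMeasurable h) :
    Measurable fun x : E n ↦ inner ℂ (e (floorVec x)) (h (torusPart x)) := by
  have h1 : Measurable fun p : torus n × (Fin n → ℤ) ↦ inner ℂ (e p.2) (h p.1) :=
    measurable_from_prod_countable_left fun k ↦
      (stronglyMeasurable_const.inner (𝕜 := ℂ) (f := fun _ ↦ e k) hh).measurable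
  exact h1.comp (measurable_torusPart.prodMk measurable_floorVec)

lemma fiberIsometry_surjective (n : ℕ) (s : ℝ) : Function.Surjective (fiberIsometry n s) := by
  intro h
  -- Glue the weighted coordinates of `h` together: on the cell `k + 𝕋ⁿ`, `G` is the `k`-th one.
  let G : E n → ℂ := fun x ↦ inner ℂ (weightedSeqBasis n s (floorVec x)) (h (torusPart x))
  have hG : Measurable G := measurable_inner_torusPart _ (Lp.stronglyMeasurable h)
  have hGh : ∀ (t : torus n) k,
      weightedSeqEquiv n s (h t) k = G ((t : E n) + latticePoint k) := fun t k ↦ by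
    simp only [G, torusPart_add_latticePoint, floorVec_add_latticePoint,
      inner_weightedSeqBasis]
  have hGL : MemLp G 2 volume := ⟨hG.aestronglyMeasurable, by
    rw [← eLpNorm_eq_of_ae_fiber hG (Filter.Eventually.of_forall hGh)]
    exact Lp.eLpNorm_lt_top h⟩
  obtain ⟨f, hf⟩ := weightedFourier_surjective n s (hGL.toLp G)
  refine ⟨f, Lp.ext ?_⟩
  have hfG : ∀ᵐ x, weightedFourier n s f x = G x := by rw [hf]; exact hGL.coeFn_toLp
  filter_upwards [(memLp_fiber f).coeFn_toLp, weightedSeqEquiv_fiber f, ae_torus_of_ae hfG]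
    with t h1 h2 h3
  refine h1.trans (weightedSeq_ext fun k ↦ ?_)
  rw [h2, h3, hGh]

/-- The mapping `𝒯_s` as an isometric isomorphism of `H^s` onto `L²(𝕋ⁿ; ℓ²_s)`. -/
def fiberEquiv (n : ℕ) (s : ℝ) :
    SobolevSpace n s ≃ₗᵢ[ℂ] Lp (WeightedSeq n s) 2 (volume : Measure (torus n)) :=
  .ofSurjective (fiberIsometry n s) (fiberIsometry_surjective n s)

lemma fiberEquiv_ae_eq (f : SobolevSpace n s) :
    ∀ᵐ t : torus n, fiberEquiv n s f t = fiber f t :=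
  (memLp_fiber f).coeFn_toLp

instance (n : ℕ) (s : ℝ) : CompleteSpace (SobolevSpace n s) :=
  (completeSpace_congr (e := (fiberEquiv n s).toEquiv)
    (fiberEquiv n s).isometry.isUniformEmbedding).2 inferInstance

instance (n : ℕ) (s : ℝ) : SecondCountableTopology (SobolevSpace n s) :=
  have : Fact ((2 : ℝ≥0∞) ≠ ⊤) := ⟨by norm_num⟩
  have : Topology.IsInducing (weightedFourier n s) := ⟨rfl⟩
  this.secondCountableTopology

end FiberMap

/-! ### Integer translations on the fiber side. -/

section Translation

variable {n : ℕ} {s : ℝ}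

lemma norm_character (a x : E n) : ‖character a x‖ = 1 := by
  rw [character, Complex.norm_exp]; simp

lemma character_add_latticePoint (k m : Fin n → ℤ) (x : E n) :
    character (latticePoint k) (x + latticePoint m) = character (latticePoint k) x := by
  have hint : (inner ℝ (latticePoint m) (latticePoint k) : ℝ) = ((∑ i, m i * k i : ℤ) : ℝ) := by
    simp [latticePoint, PiLp.inner_apply, mul_comm]
  rw [character, character, Complex.exp_eq_exp_iff_exists_int]
  refine ⟨-∑ i, m i * k i, ?_⟩
  rw [inner_add_left, hint]
  push_cast
  ring

/-- Translation is the Fourier multiplier with symbol the character, and multiplication by it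
commutes with the weight. -/
lemma weightedFourier_translate (k : Fin n → ℤ) (f : SobolevSpace n s) :
    ∀ᵐ x, weightedFourier n s (translate k f) x
      = character (latticePoint k) x * weightedFourier n s f x := by
  have hχ := hasTemperateGrowth_character (latticePoint k)
  have hw : (fun x : E n ↦ ((weight n s x : ℝ) : ℂ)).HasTemperateGrowth := by
    unfold weight; fun_prop
  have hL : MemLp (character (latticePoint k)) ∞ (volume : Measure (E n)) :=
    memLp_top_of_bound hχ.1.continuous.aestronglyMeasurable 1
      (Filter.Eventually.of_forall fun x ↦ (norm_character _ x).le)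
  have h : weightedFourier n s (translate k f)
      = (hL.toLp _ • weightedFourier n s f : Lp ℂ 2 volume) := by
    apply toTemperedDistribution_injective
    rw [Lp.toTemperedDistribution_smul_eq hχ, ← weightedFourier_spec, ← weightedFourier_spec]
    change smulLeftCLM ℂ _ (𝓕 (translateDistribution (latticePoint k) f.toDistribution)) = _
    rw [translateDistribution_eq, fourierMultiplierCLM_apply,
      FourierTransform.fourier_fourierInv_eq, smulLeftCLM_smulLeftCLM_apply hχ hw,
      smulLeftCLM_smulLeftCLM_apply hw hχ, mul_comm]
  rw [h]
  filter_upwards [Lp.coeFn_lpSMul (r := 2) (hL.toLp _) (weightedFourier n s f), hL.coeFn_toLp]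
    with x h1 h2
  rw [h1, Pi.smul_apply', h2, smul_eq_mul]

lemma fiberEquiv_translate (k : Fin n → ℤ) (f : SobolevSpace n s) :
    ∀ᵐ t : torus n, fiberEquiv n s (translate k f) t
      = character (latticePoint k) (t : E n) • fiberEquiv n s f t := by
  filter_upwards [fiberEquiv_ae_eq f, fiberEquiv_ae_eq (translate k f), weightedSeqEquiv_fiber f,
    weightedSeqEquiv_fiber (translate k f), ae_torus_of_ae (weightedFourier_translate k f)]
    with t h1 h2 h3 h4 h5
  rw [h1, h2]
  refine weightedSeq_ext fun m ↦ ?_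
  rw [h4, h5, map_smul, lp.coeFn_smul, Pi.smul_apply, h3, character_add_latticePoint, smul_eq_mul]

lemma norm_translate (k : Fin n → ℤ) (f : SobolevSpace n s) : ‖translate k f‖ = ‖f‖ := by
  rw [← (fiberEquiv n s).norm_map, ← (fiberEquiv n s).norm_map f, Lp.norm_def, Lp.norm_def]
  refine congrArg ENNReal.toReal (eLpNorm_congr_norm_ae ?_)
  filter_upwards [fiberEquiv_translate k f] with t ht
  rw [ht, norm_smul, norm_character, one_mul]

lemma translate_sub (k : Fin n → ℤ) (f g : SobolevSpace n s) :
    translate k (f - g) = translate k f - translate k g :=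
  Subtype.ext ((translateDistribution (latticePoint k)).map_sub f.toDistribution g.toDistribution)

lemma continuous_translate (k : Fin n → ℤ) :
    Continuous (translate k : SobolevSpace n s → SobolevSpace n s) := by
  refine (LipschitzWith.of_dist_le_mul (K := 1) fun f g ↦ ?_).continuous
  rw [dist_eq_norm, dist_eq_norm, ← translate_sub, norm_translate, NNReal.coe_one, one_mul]

end Translation

/-! ### Range functions of closed SI spaces and the closure of `L(V)`. -/

section ShiftInvariantSpaces

variable {n : ℕ} {s : ℝ} {V : Submodule ℂ (SobolevSpace n s)}

lemma isRangeFunctionOf_fiberSpan (hVc : IsClosed (V : Set (SobolevSpace n s)))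
    (hV : IsShiftInvariant V) {u : ℕ → SobolevSpace n s} (hu : ∀ i, u i ∈ V)
    (huV : (V : Set (SobolevSpace n s)) ⊆ closure (Set.range u)) :
    IsRangeFunctionOf (fiberSpan (fiberEquiv n s) u) V := by
  have : CompleteSpace V := hVc.completeSpace_coe
  have hχ := isDetermining_character n
  refine ⟨fun a b ↦ aemeasurable_inner_starProjection_fiberSpan hχ fiberEquiv_translate
    (fun k f hf ↦ hV f hf k) hu huV a b, fun f ↦ ?_⟩
  rw [mem_iff_ae_mem_fiberSpan hχ fiberEquiv_translate (fun k f hf ↦ hV f hf k) hu huV f]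
  refine Filter.eventually_congr ?_
  filter_upwards [fiberEquiv_ae_eq f] with t ht
  rw [ht]

lemma ae_eq_fiberSpan_of_isRangeFunctionOf {J : RangeFunction n s} (hJ : IsRangeFunctionOf J V)
    {u : ℕ → SobolevSpace n s} (hu : ∀ i, u i ∈ V)
    (huV : (V : Set (SobolevSpace n s)) ⊆ closure (Set.range u)) :
    ∀ᵐ t : torus n, J t = fiberSpan (fiberEquiv n s) u t := by
  refine ae_eq_fiberSpan (weightedSeqBasis n s) hu huV hJ.1 fun f ↦ ?_
  rw [hJ.2]
  refine Filter.eventually_congr ?_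
  filter_upwards [fiberEquiv_ae_eq f] with t ht
  rw [ht]

lemma isShiftInvariant_closureImage (hV : IsShiftInvariant V) {L : V →L[ℂ] V}
    (hL : IsShiftPreserving hV L) : IsShiftInvariant (closureImage L) := by
  intro f hf k
  refine map_mem_closure (continuous_translate k) hf ?_
  rintro _ ⟨_, ⟨g, rfl⟩, rfl⟩
  exact ⟨_, ⟨⟨translate k g, hV g g.2 k⟩, rfl⟩, hL k g⟩

lemma closureImage_subset_closure_range (L : V →L[ℂ] V) {u : ℕ → V} (hu : DenseRange u) :
    (closureImage L : Set (SobolevSpace n s)) ⊆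
      closure (Set.range fun i ↦ (L (u i) : SobolevSpace n s)) := by
  refine closure_minimal ?_ isClosed_closure
  rintro _ ⟨_, ⟨g, rfl⟩, rfl⟩
  have h := map_mem_closure (continuous_subtype_val.comp L.continuous) (hu g)
    (t := Set.range fun i ↦ (L (u i) : SobolevSpace n s))
    (by rintro _ ⟨i, rfl⟩; exact ⟨i, rfl⟩)
  exact h

end ShiftInvariantSpaces

end SobolevSI

end

theorem mainTheorem4 (n : ℕ) (s : ℝ)
    (V : Submodule ℂ (SobolevSI.SobolevSpace n s))
    (hVclosed : IsClosed (V : Set (SobolevSI.SobolevSpace n s)))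
    (hV : SobolevSI.IsShiftInvariant V)
    (L : V →L[ℂ] V) (hL : SobolevSI.IsShiftPreserving hV L) :
    IsClosed (SobolevSI.closureImage L : Set (SobolevSI.SobolevSpace n s)) ∧
    SobolevSI.IsShiftInvariant (SobolevSI.closureImage L) ∧
    (∃ J : SobolevSI.RangeFunction n s, SobolevSI.IsRangeFunctionOf J V) ∧
    (∃ J' : SobolevSI.RangeFunction n s,
      SobolevSI.IsRangeFunctionOf J' (SobolevSI.closureImage L)) ∧
    ∀ J J' : SobolevSI.RangeFunction n s,
      SobolevSI.IsRangeFunctionOf J V →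
      SobolevSI.IsRangeFunctionOf J' (SobolevSI.closureImage L) →
      ∀ᵐ t : SobolevSI.torus n, J'.dim t ≤ J.dim t := by
  have hcl : IsClosed (SobolevSI.closureImage L : Set (SobolevSI.SobolevSpace n s)) :=
    Submodule.isClosed_topologicalClosure _
  have hSI := SobolevSI.isShiftInvariant_closureImage hV hL
  have : CompleteSpace V := hVclosed.completeSpace_coe
  obtain ⟨u, hu⟩ := TopologicalSpace.exists_dense_seq V
  have huV : (V : Set (SobolevSI.SobolevSpace n s)) ⊆
      closure (Set.range fun i ↦ (u i : SobolevSI.SobolevSpace n s)) := fun f hf ↦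
    map_mem_closure continuous_subtype_val (hu ⟨f, hf⟩) (by rintro _ ⟨i, rfl⟩; exact ⟨i, rfl⟩)
  have hLV := SobolevSI.closureImage_subset_closure_range L hu
  have hLu : ∀ i, (L (u i) : SobolevSI.SobolevSpace n s) ∈ SobolevSI.closureImage L := fun i ↦
    Submodule.le_topologicalClosure _ ⟨_, ⟨u i, rfl⟩, rfl⟩
  refine ⟨hcl, hSI,
    ⟨_, SobolevSI.isRangeFunctionOf_fiberSpan hVclosed hV (fun i ↦ (u i).2) huV⟩,
    ⟨_, SobolevSI.isRangeFunctionOf_fiberSpan hcl hSI hLu hLV⟩, fun J J' hJ hJ' ↦ ?_⟩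
  filter_upwards [SobolevSI.ae_eq_fiberSpan_of_isRangeFunctionOf hJ (fun i ↦ (u i).2) huV,
    SobolevSI.ae_eq_fiberSpan_of_isRangeFunctionOf hJ' hLu hLV,
    SobolevSI.ae_toENat_rank_fiberSpan_le (SobolevSI.isDetermining_character n)
      SobolevSI.fiberEquiv_translate (u := fun i ↦ (u i : SobolevSI.SobolevSpace n s))
      (v := fun i ↦ (L (u i) : SobolevSI.SobolevSpace n s))
      -- The adjoint is taken in the Hilbert space `V`. It need not be shown to be shift-preserving:
      -- moving `T_k` through `L` suffices.
      (w := fun j ↦ (ContinuousLinearMap.adjoint L (u j) : SobolevSI.SobolevSpace n s))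
      (fun i ↦ huV (L (u i)).2) fun k i j ↦ by
        rw [← hL k (u i)]
        exact (ContinuousLinearMap.adjoint_inner_right L ⟨_, hV _ (u i).2 k⟩ (u j)).symm]
    with t h1 h2 h3
  rw [SobolevSI.RangeFunction.dim, SobolevSI.RangeFunction.dim, h1, h2]
  exact h3
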